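/- Let $E$ be a (complex) Fréchet space and let $B \subset E$ be a balanced convex compact set with $B \neq \emptyset$ and $B \neq \{0\}$. Let $E_B$ denote the linear hull of $B$, equipped with the norm $\|\cdot\|_B$ given by the gauge functional of $B$. Let $(P_n)_{n \ge 1}$ be a sequence of continuous homogeneous polynomials $P_n : E \to \mathbb{C}$, where the degree of $P_n$ is at most $n$. A function $\varphi : E_B \to [-\infty, +\infty)$ is called homogeneous plurisubharmonic if it is upper semicontinuous, its restriction to every complex affine line is subharmonic or identically $-\infty$, and $\varphi(\lambda z) = \log|\lambda| + \varphi(z)$ for all $\lambda \in \mathbb{C}$ and $z \in E_B$ (with $\log 0 = -\infty$). A set $A \subset E_B$ is called projectively pluripolar in $E_B$ if there is a homogeneous plurisubharmonic function $\varphi \not\equiv -\infty$ on $E_B$ with $\varphi = -\infty$ on $A$. Assume that the set $$ \Big\{ z \in E_B : \ \sup_{n \ge 1} \frac1n \log |P_n(z)| < \infty \Big\} $$ is not projectively pluripolar in $E_B$. Then the family $\big(\frac1n \log|P_n|\big)_{n \ge 1}$ is locally uniformly bounded from above on $E_B$: every $z \in E_B$ has a neighbourhood $U$ in $(E_B, \|\cdot\|_B)$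 and a constant $M \in \mathbb{R}$ such that $\frac1n \log|P_n(w)| \le M$ for all $n \ge 1$ and all $w \in U$. -/

import Mathlib

open Topology Pointwise

noncomputable section

/-! ### The normed space `E_B` spanned by a balanced convex compact set -/

/-- `B` is a (non-empty) balanced convex compact subset of the complex topological vector
space `E`. -/
structure IsCompactDisk {E : Type*} [AddCommGroup E] [Module ℂ E] [TopologicalSpace E]
    (B : Set E) : Prop where
  nonempty : B.Nonempty
  balanced : Balanced ℂ B
  convex : Convex ℝ B
  isCompact : IsCompact B

/-- The space `E_B`: the linear hull of `B`. It is a type of its own, because it carries the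
topology of the norm `‖·‖_B` below and not the topology induced by `E`. -/
def DiskHull {E : Type*} [AddCommGroup E] [Module ℂ E] [TopologicalSpace E]
    {B : Set E} (_hB : IsCompactDisk B) : Type _ :=
  Submodule.span ℂ B

namespace DiskHull

variable {E : Type*} [AddCommGroup E] [Module ℂ E] [TopologicalSpace E]
  {B : Set E} (hB : IsCompactDisk B)

instance : AddCommGroup (DiskHull hB) :=
  inferInstanceAs (AddCommGroup (Submodule.span ℂ B))

instance : Module ℂ (DiskHull hB) :=
  inferInstanceAs (Module ℂ (Submodule.span ℂ B))

/-- The inclusion of `E_B` into `E`. -/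
def incl : DiskHull hB →ₗ[ℂ] E := (Submodule.span ℂ B).subtype

/-- The norm `‖·‖_B` of `E_B` is the gauge functional of `B`. -/
instance : Norm (DiskHull hB) := ⟨fun x => gauge B (incl hB x)⟩

theorem norm_def (x : DiskHull hB) : ‖x‖ = gauge B (incl hB x) := rfl

theorem exists_mem_smul (x : DiskHull hB) : ∃ r : ℝ, 0 ≤ r ∧ incl hB x ∈ r • B := by
  have key : ∀ y ∈ Submodule.span ℂ B, ∃ r : ℝ, 0 ≤ r ∧ y ∈ r • B := by
    intro y hy
    induction hy using Submodule.span_induction with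
    | mem y h => exact ⟨1, zero_le_one, by simpa using h⟩
    | zero =>
      obtain ⟨b, hb⟩ := hB.nonempty
      exact ⟨0, le_rfl, b, hb, by simp⟩
    | add y z _ _ hy hz =>
      obtain ⟨r, hr, hy⟩ := hy
      obtain ⟨s, hs, hz⟩ := hz
      refine ⟨r + s, add_nonneg hr hs, ?_⟩
      rw [hB.convex.add_smul hr hs]
      exact Set.add_mem_add hy hz
    | smul c y _ hy =>
      obtain ⟨r, hr, b, hb, rfl⟩ := hy
      refine ⟨‖c‖ * r, by positivity, ?_⟩
      have h1 : c • b ∈ ((‖c‖ : ℝ) : ℂ) • B :=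
        hB.balanced.smul_mono (by simp) ⟨b, hb, rfl⟩
      obtain ⟨d, hd, hdb⟩ := h1
      refine ⟨d, hd, ?_⟩
      have h2 : ‖c‖ • d = c • b := by
        rw [← hdb]; exact (Complex.coe_smul ‖c‖ d).symm
      change (‖c‖ * r) • d = c • (r • b)
      rw [mul_comm, mul_smul, h2, smul_comm]
  exact key _ x.2

theorem gauge_preimage (x : DiskHull hB) : gauge (incl hB ⁻¹' B) x = ‖x‖ := by
  rw [norm_def, gauge_def', gauge_def']
  rfl

theorem convex_preimage : Convex ℝ (incl hB ⁻¹' B) :=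
  hB.convex.linear_preimage ((incl hB).restrictScalars ℝ)

theorem balanced_preimage : Balanced ℂ (incl hB ⁻¹' B) := by
  rintro a ha _ ⟨x, hx, rfl⟩
  have := hB.balanced a ha ⟨_, hx, rfl⟩
  simpa using this

theorem absorbent_preimage : Absorbent ℝ (incl hB ⁻¹' B) := by
  intro x
  obtain ⟨r, hr, hx⟩ := exists_mem_smul hB x
  refine Absorbs.of_norm ⟨r + 1, fun c hc => ?_⟩
  have hc0 : c ≠ 0 := by
    rintro rfl
    rw [norm_zero] at hc
    linarith
  obtain ⟨b, hb, hbx⟩ := hx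
  have hmem : ((c⁻¹ * r : ℝ) : ℂ) • b ∈ B := by
    refine hB.balanced _ ?_ ⟨b, hb, rfl⟩
    rw [Complex.norm_real, norm_mul, norm_inv, Real.norm_of_nonneg hr]
    have : 0 < ‖c‖ := norm_pos_iff.mpr hc0
    rw [inv_mul_le_iff₀ this]
    linarith
  rw [Set.singleton_subset_iff, Set.mem_smul_set_iff_inv_smul_mem₀ hc0]
  change c⁻¹ • incl hB x ∈ B
  rw [← hbx]
  rw [Complex.coe_smul, mul_smul] at hmem
  exact hmem

theorem norm_eq_zero_iff [IsTopologicalAddGroup E] [ContinuousSMul ℂ E] [T2Space E]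
    (x : DiskHull hB) : ‖x‖ = 0 ↔ x = 0 := by
  have hb : Bornology.IsVonNBounded ℝ B := (hB.isCompact.isVonNBounded ℂ).restrict_scalars ℝ
  let : TopologicalSpace (DiskHull hB) := TopologicalSpace.induced (incl hB) inferInstance
  have : T2Space (DiskHull hB) :=
    T2Space.of_injective_continuous (Submodule.subtype_injective _) continuous_induced_dom
  have hb' : Bornology.IsVonNBounded ℝ (incl hB ⁻¹' B) := by
    intro V hV
    rw [nhds_induced, Filter.mem_comap] at hV
    obtain ⟨W, hW, hWV⟩ := hV
    rw [map_zero] at hW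
    obtain ⟨r, hr⟩ := (hb hW).exists_pos
    refine Absorbs.of_norm ⟨r, fun c hc => ?_⟩
    have hc0 : c ≠ 0 := by
      rintro rfl
      rw [norm_zero] at hc
      linarith [hr.1]
    intro y hy
    have := hr.2 c hc hy
    rw [Set.mem_smul_set_iff_inv_smul_mem₀ hc0] at this ⊢
    exact hWV this
  rw [← gauge_preimage]
  exact gauge_eq_zero (absorbent_preimage hB) hb'

theorem normedSpaceCore [IsTopologicalAddGroup E] [ContinuousSMul ℂ E] [T2Space E] :
    NormedSpace.Core ℂ (DiskHull hB) where
  norm_nonneg x := gauge_nonneg _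
  norm_smul c x := by
    rw [← gauge_preimage, ← gauge_preimage, gauge_smul (balanced_preimage hB)]
  norm_triangle x y := by
    rw [← gauge_preimage, ← gauge_preimage, ← gauge_preimage]
    exact gauge_add_le (convex_preimage hB) (absorbent_preimage hB) x y
  norm_eq_zero_iff := norm_eq_zero_iff hB

instance [IsTopologicalAddGroup E] [ContinuousSMul ℂ E] [T2Space E] :
    NormedAddCommGroup (DiskHull hB) :=
  NormedAddCommGroup.ofCore (normedSpaceCore hB)

instance [IsTopologicalAddGroup E] [ContinuousSMul ℂ E] [T2Space E] :
    NormedSpace ℂ (DiskHull hB) :=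
  NormedSpace.ofCore (normedSpaceCore hB)

end DiskHull

/-! ### Plurisubharmonic functions and projectively pluripolar sets -/

/-- The mean of `u : ℂ → [-∞, ∞)` over the circle with centre `c` and radius `R`, that is
`(1 / 2π) ∫ u (c + R e^{iθ}) dθ ∈ [-∞, ∞)`. It is written as the infimum (which is the limit)
of the means of the truncations `max u (-N)`. For an upper semicontinuous `u < ∞` these are bounded
and measurable on the circle, so by monotone convergence this is the Lebesgue integral mean. -/
def circleMean (u : ℂ → EReal) (c : ℂ) (R : ℝ) : EReal :=
  ⨅ N : ℕ, ((Real.circleAverage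
    (fun z => (max (u z) ((-(N : ℝ) : ℝ) : EReal)).toReal) c R : ℝ) : EReal)

/-- `u` is subharmonic on the open set `U ⊆ ℂ`: it is upper semicontinuous with values in
`[-∞, ∞)` and is at most its mean over the circle at the centre of every closed disc in `U`.
As usual for restrictions to complex lines, `u ≡ -∞` is allowed. -/
structure IsSubharmonicOn (u : ℂ → EReal) (U : Set ℂ) : Prop where
  upperSemicontinuousOn : UpperSemicontinuousOn u U
  ne_top : ∀ z ∈ U, u z ≠ ⊤
  le_circleMean : ∀ (c : ℂ) (R : ℝ), 0 < R → Metric.closedBall c R ⊆ U → u c ≤ circleMean u c R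

/-- `φ` is plurisubharmonic on the open subset `D` of a complex topological vector space: it is
upper semicontinuous with values in `[-∞, ∞)`, and subharmonic on each one-dimensional affine
section of `D`. -/
structure IsPlurisubharmonicOn {X : Type*} [AddCommGroup X] [Module ℂ X] [TopologicalSpace X]
    (φ : X → EReal) (D : Set X) : Prop where
  upperSemicontinuousOn : UpperSemicontinuousOn φ D
  ne_top : ∀ x ∈ D, φ x ≠ ⊤
  subharmonic : ∀ a b : X, IsSubharmonicOn (fun ζ : ℂ => φ (a + ζ • b)) {ζ : ℂ | a + ζ • b ∈ D}

/-- The class `HPSH(X)` of homogeneous plurisubharmonic functions on `X`: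
`φ(λ x) = log |λ| + φ(x)` for all `λ ∈ ℂ` and `x ∈ X`, where `log 0 = -∞`. -/
structure IsHomogeneousPSH {X : Type*} [AddCommGroup X] [Module ℂ X] [TopologicalSpace X]
    (φ : X → EReal) : Prop where
  plurisubharmonic : IsPlurisubharmonicOn φ Set.univ
  map_smul : ∀ (l : ℂ) (x : X), φ (l • x) = ENNReal.log ‖l‖ₑ + φ x

/-- `A` is projectively pluripolar in `X`: it is contained in the `-∞` locus of some
`φ ∈ HPSH(X)` which is not identically `-∞`. -/
def IsProjectivelyPluripolar {X : Type*} [AddCommGroup X] [Module ℂ X] [TopologicalSpace X]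
    (A : Set X) : Prop :=
  ∃ φ : X → EReal, IsHomogeneousPSH φ ∧ (∃ x, φ x ≠ ⊥) ∧ ∀ x ∈ A, φ x = ⊥

/-! ### Polynomials and local boundedness -/

/-- `P` is a continuous homogeneous polynomial of degree `k`: it is continuous, and it is the
restriction of a `k`-linear form to the diagonal. -/
structure IsContinuousHomogeneousPolynomial {E : Type*} [AddCommGroup E] [Module ℂ E]
    [TopologicalSpace E] (k : ℕ) (P : E → ℂ) : Prop where
  continuous : Continuous P
  exists_multilinear : ∃ m : MultilinearMap ℂ (fun _ : Fin k => E) ℂ, ∀ z, P z = m fun _ => z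

/-- The function `(1 / n) log |P|` with values in `[-∞, ∞)` (for `n ≥ 1`). -/
def logRoot {E : Type*} (n : ℕ) (P : E → ℂ) (z : E) : EReal :=
  (((n : ℝ)⁻¹ : ℝ) : EReal) * ENNReal.log ‖P z‖ₑ

/-- The family `(u n)_{n ≥ 1}` is locally uniformly bounded from above on `X`. -/
def LocallyUniformlyBddAbove {X : Type*} [TopologicalSpace X] (u : ℕ → X → EReal) : Prop :=
  ∀ x : X, ∃ U ∈ 𝓝 x, ∃ M : ℝ, ∀ n : ℕ, 1 ≤ n → ∀ y ∈ U, u n y ≤ (M : EReal)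

end

/-! Put `M n = max_B |P n|`. If `M n ≤ exp (C n)` for some `C` and all `n`, homogeneity bounds the
family on every ball of `E_B`. Otherwise some `φ` homogeneous plurisubharmonic, not identically
`-∞`, is `-∞` on the whole set where the family is pointwise bounded, a contradiction.

Choose indices `n_j` with `M (n_j)` huge, let `d_j` be the degree and `p_j = P (n_j) / M (n_j)`, so
that `|p_j x| ≤ ‖x‖ ^ d_j`. For weights `c_j > 0` with partial sums below `1`, the means `∏ |p_j| ^
(c_j / d_j) * ‖x‖ ^ (1 - ∑ c_j)` are homogeneous of degree one and decrease with the number of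
factors; `φ` is the logarithm of their limit (`isHomogeneousPSH_weightedMean`).

Where the family is bounded, the growth of `M (n_j)` keeps almost all factors below a constant `q <
1`, so `φ = -∞` there. To find a point with `φ > -∞`, the maximum principle
(`exists_pow_mul_norm_le`) shows that `p_j` cannot be small on all of a ball of radius `r_j`: it
exceeds `(r_j / 4) ^ d_j` on a smaller ball, inside which the construction continues. The nested
balls meet because closed balls of `E_B` are compact in `E`. The choice `c_j = r_j ^ 2 / 4` serves
both purposes. -/

/-! ### The sub-mean value inequality for logarithms -/

/-- `log h` satisfies the sub-mean value inequality at the centre of the circle `C(c, R)`, in the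
form that it dominates almost everywhere on the circle an integrable function whose mean is at
least `log (h c)`. -/
def LogSubmeanAt (h : ℂ → ℝ) (c : ℂ) (R : ℝ) : Prop :=
  0 < h c → ∃ v : ℂ → ℝ, CircleIntegrable v c R ∧ Real.log (h c) ≤ Real.circleAverage v c R ∧
    ∀ᵐ θ : ℝ, 0 < h (circleMap c R θ) ∧ v (circleMap c R θ) ≤ Real.log (h (circleMap c R θ))

/-- Jensen's formula: every zero `u` in the disc contributes a term `log (R / ‖c - u‖) ≥ 0`, with
its multiplicity. -/
theorem Differentiable.log_norm_le_circleAverage {p : ℂ → ℂ} (hp : Differentiable ℂ p) {c : ℂ}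
    {R : ℝ} (hR : 0 < R) (hc : p c ≠ 0) :
    Real.log ‖p c‖ ≤ Real.circleAverage (fun z => Real.log ‖p z‖) c R := by
  have ha : AnalyticOnNhd ℂ p (Metric.closedBall c |R|) := fun z _ => hp.analyticAt z
  rw [ha.circleAverage_log_norm hR.ne' hc]
  refine le_add_of_nonneg_left (finsum_nonneg fun u => ?_)
  by_cases hu : u ∈ Metric.closedBall c |R|
  · refine mul_nonneg (mod_cast MeromorphicOn.AnalyticOnNhd.divisor_nonneg ha u) ?_
    rcases eq_or_ne c u with rfl | hne
    · simp
    · have h0 : 0 < ‖c - u‖ := norm_pos_iff.mpr (sub_ne_zero.mpr hne)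
      rw [Metric.mem_closedBall, dist_comm, dist_eq_norm, abs_of_pos hR] at hu
      refine Real.log_nonneg ?_
      rw [← div_eq_mul_inv, one_le_div h0]
      exact hu
  · rw [Function.locallyFinsuppWithin.apply_eq_zero_of_notMem _ hu]
    simp

/-- The zeros of an entire function that is not identically zero are isolated, so they meet the
circle in a null set of angles. -/
theorem Differentiable.ae_circleMap_ne_zero {p : ℂ → ℂ} (hp : Differentiable ℂ p) {c : ℂ}
    {R : ℝ} (hR : 0 < R) (hc : p c ≠ 0) : ∀ᵐ θ : ℝ, p (circleMap c R θ) ≠ 0 := by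
  have ha : AnalyticOnNhd ℂ p Set.univ := fun z _ => hp.analyticAt z
  have h1 : p ⁻¹' {0}ᶜ ∈ Filter.codiscrete ℂ := ha.preimage_zero_mem_codiscrete hc
  have h2 := Filter.codiscreteWithin_mono (Set.subset_univ (Metric.sphere c |R|)) h1
  have h3 := circleMap_preimage_codiscrete hR.ne' h2
  have h4 := ae_restrict_le_codiscreteWithin (μ := MeasureTheory.volume) MeasurableSet.univ h3
  rw [MeasureTheory.Measure.restrict_univ] at h4
  exact h4

namespace LogSubmeanAt

variable {h g : ℂ → ℝ} {c : ℂ} {R : ℝ}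

theorem norm_of_differentiable {p : ℂ → ℂ} (hp : Differentiable ℂ p) (hR : 0 < R) :
    LogSubmeanAt (fun z => ‖p z‖) c R := by
  intro hc
  have hc' : p c ≠ 0 := norm_pos_iff.mp hc
  refine ⟨fun z => Real.log ‖p z‖, ?_, hp.log_norm_le_circleAverage hR hc', ?_⟩
  · exact MeromorphicOn.circleIntegrable_log_norm fun z _ => (hp.analyticAt z).meromorphicAt
  · filter_upwards [hp.ae_circleMap_ne_zero hR hc'] with θ hθ
    exact ⟨norm_pos_iff.mpr hθ, le_rfl⟩

theorem one : LogSubmeanAt (fun _ => 1) c R := fun _ =>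
  ⟨fun _ => 0, circleIntegrable_const 0 c R, by simp [Real.circleAverage_const], by simp⟩

theorem mono (hg : LogSubmeanAt g c R) (hgh : ∀ z, g z ≤ h z) (hc : h c = g c) :
    LogSubmeanAt h c R := by
  intro h0
  rw [hc] at h0 ⊢
  obtain ⟨v, hv, hvc, hva⟩ := hg h0
  refine ⟨v, hv, hvc, hva.mono fun θ hθ => ⟨hθ.1.trans_le (hgh _), hθ.2.trans ?_⟩⟩
  exact Real.log_le_log hθ.1 (hgh _)

theorem mul (hg : LogSubmeanAt g c R) (hh : LogSubmeanAt h c R) (hg0 : 0 ≤ g c) (hh0 : 0 ≤ h c) :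
    LogSubmeanAt (fun z => g z * h z) c R := by
  intro h0
  have hg1 : 0 < g c := hg0.lt_of_ne' (left_ne_zero_of_mul h0.ne')
  have hh1 : 0 < h c := hh0.lt_of_ne' (right_ne_zero_of_mul h0.ne')
  obtain ⟨v, hv, hvc, hva⟩ := hg hg1
  obtain ⟨w, hw, hwc, hwa⟩ := hh hh1
  refine ⟨fun z => v z + w z, hv.add hw, ?_, ?_⟩
  · rw [Real.circleAverage_fun_add hv hw, Real.log_mul hg1.ne' hh1.ne']
    exact add_le_add hvc hwc
  · filter_upwards [hva, hwa] with θ h1 h2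
    refine ⟨mul_pos h1.1 h2.1, ?_⟩
    rw [Real.log_mul h1.1.ne' h2.1.ne']
    exact add_le_add h1.2 h2.2

theorem rpow (hg : LogSubmeanAt g c R) (hg0 : 0 ≤ g c) {a : ℝ} (ha : 0 < a) :
    LogSubmeanAt (fun z => g z ^ a) c R := by
  intro h0
  have hg1 : 0 < g c := by
    refine hg0.lt_of_ne' fun h => ?_
    simp only [h, Real.zero_rpow ha.ne', lt_irrefl] at h0
  obtain ⟨v, hv, hvc, hva⟩ := hg hg1
  refine ⟨fun z => a • v z, hv.const_smul, ?_, ?_⟩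
  · rw [Real.circleAverage_fun_smul, Real.log_rpow hg1]
    exact mul_le_mul_of_nonneg_left hvc ha.le
  · filter_upwards [hva] with θ h1
    refine ⟨Real.rpow_pos_of_pos h1.1 _, ?_⟩
    rw [Real.log_rpow h1.1]
    exact mul_le_mul_of_nonneg_left h1.2 ha.le

theorem prod {ι : Type*} (s : Finset ι) {f : ι → ℂ → ℝ} (hf : ∀ i ∈ s, LogSubmeanAt (f i) c R)
    (hf0 : ∀ i ∈ s, 0 ≤ f i c) : LogSubmeanAt (fun z => ∏ i ∈ s, f i z) c R := by
  classical
  induction s using Finset.induction_on with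
  | empty => simpa using one
  | insert i s hi ih =>
    simp only [Finset.prod_insert hi]
    simp only [Finset.mem_insert, forall_eq_or_imp] at hf hf0
    exact mul hf.1 (ih hf.2 hf0.2) hf0.1 (Finset.prod_nonneg hf0.2)

/-- By Hahn–Banach the norm dominates `|g|` for a functional `g` of norm at most one, with equality
at the centre of the circle, and `g` is affine along the line. -/
theorem norm_add_smul {X : Type*} [NormedAddCommGroup X] [NormedSpace ℂ X] (a b : X)
    (hR : 0 < R) : LogSubmeanAt (fun z => ‖a + z • b‖) c R := by
  obtain ⟨g, hg, hgc⟩ := exists_dual_vector'' ℂ (a + c • b)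
  refine mono (g := fun z => ‖g (a + z • b)‖) (norm_of_differentiable ?_ hR) (fun z => ?_) ?_
  · simp only [map_add, map_smul, smul_eq_mul]
    fun_prop
  · simpa using g.le_of_opNorm_le hg (a + z • b)
  · rw [hgc]; simp

theorem log_le_circleAverage (hh : LogSubmeanAt h c R) (hcont : Continuous h) (hc : 0 < h c)
    {ε : ℝ} (hε : 0 < ε) :
    Real.log (h c) ≤ Real.circleAverage (fun z => Real.log (max (h z) ε)) c R := by
  obtain ⟨v, hv, hvc, hva⟩ := hh hc
  have hm : ∀ z, max (h z) ε ≠ 0 := fun z => (hε.trans_le (le_max_right _ _)).ne'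
  have hcm : Continuous fun z => Real.log (max (h z) ε) := (hcont.max continuous_const).log hm
  refine hvc.trans ?_
  refine mul_le_mul_of_nonneg_left ?_ (by positivity)
  refine intervalIntegral.integral_mono_ae Real.two_pi_pos.le hv
    (hcm.continuousOn.circleIntegrable' : CircleIntegrable _ c R) ?_
  filter_upwards [hva] with θ hθ
  exact hθ.2.trans (Real.log_le_log hθ.1 (le_max_left _ _))

end LogSubmeanAt

/-! ### Decreasing limits of logarithmically subharmonic functions -/

theorem toReal_max_log_ofReal {t : ℝ} (ht : 0 ≤ t) (T : ℝ) :
    (max (ENNReal.log (ENNReal.ofReal t)) ((-T : ℝ) : EReal)).toReal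
      = Real.log (max t (Real.exp (-T))) := by
  rcases ht.eq_or_lt with rfl | ht
  · simp [max_eq_right (Real.exp_pos _).le]
  · rw [ENNReal.log_ofReal_of_pos ht, ← EReal.coe_strictMono.monotone.map_max, EReal.toReal_coe]
    have hm : MonotoneOn Real.log (Set.Ioi 0) := Real.strictMonoOn_log.monotoneOn
    rw [hm.map_max ht (Real.exp_pos _), Real.log_exp]

section

variable {X : Type*} {f : ℕ → X → ℝ}

theorem tendsto_iInf_of_antitone (h0 : ∀ N x, 0 ≤ f N x) (hanti : ∀ N x, f (N + 1) x ≤ f N x)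
    (x : X) : Filter.Tendsto (fun N => f N x) Filter.atTop (𝓝 (⨅ N, f N x)) :=
  tendsto_atTop_ciInf (antitone_nat_of_succ_le fun N => hanti N x)
    ⟨0, by rintro _ ⟨N, rfl⟩; exact h0 N x⟩

theorem upperSemicontinuous_log_iInf [TopologicalSpace X] (h0 : ∀ N x, 0 ≤ f N x)
    (hf : ∀ N, Continuous (f N)) :
    UpperSemicontinuous fun x => ENNReal.log (ENNReal.ofReal (⨅ N, f N x)) := by
  have h1 : UpperSemicontinuous fun x => ⨅ N, f N x :=
    fun x => upperSemicontinuousAt_ciInf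
      (.of_forall fun y => ⟨0, by rintro _ ⟨N, rfl⟩; exact h0 N y⟩)
      fun N => (hf N).upperSemicontinuous x
  exact (ENNReal.continuous_log.comp ENNReal.continuous_ofReal).comp_upperSemicontinuous h1
    (ENNReal.log_monotone.comp ENNReal.ofReal_mono)

end

/-- `circleMean` is an infimum over truncations. For a fixed truncation the integrands are bounded
uniformly in `N`, so dominated convergence carries the inequality to the limit. -/
theorem isSubharmonicOn_log_iInf {f : ℕ → ℂ → ℝ} (h0 : ∀ N z, 0 ≤ f N z)
    (hf : ∀ N, Continuous (f N)) (hanti : ∀ N z, f (N + 1) z ≤ f N z)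
    (hsub : ∀ N c R, 0 < R → LogSubmeanAt (f N) c R) :
    IsSubharmonicOn (fun z => ENNReal.log (ENNReal.ofReal (⨅ N, f N z))) Set.univ where
  upperSemicontinuousOn := (upperSemicontinuous_log_iInf h0 hf).upperSemicontinuousOn _
  ne_top z _ := by simp
  le_circleMean c R hR _ := by
    have hlim := tendsto_iInf_of_antitone h0 hanti
    have hg0 : ∀ z, 0 ≤ ⨅ N, f N z := fun z => Real.iInf_nonneg fun N => h0 N z
    have hle : ∀ N z, f N z ≤ f 0 z := fun N z =>
      antitone_nat_of_succ_le (f := fun N => f N z) (fun N => hanti N z) (Nat.zero_le N)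
    have hgle : ∀ N z, ⨅ N, f N z ≤ f N z := fun N z =>
      ciInf_le ⟨0, by rintro _ ⟨N, rfl⟩; exact h0 N z⟩ N
    rcases (hg0 c).eq_or_lt with hc | hc
    · rw [← hc]
      simp
    refine le_iInf fun T => ?_
    simp only [toReal_max_log_ofReal (hg0 _)]
    rw [ENNReal.log_ofReal_of_pos hc, EReal.coe_le_coe_iff]
    set ε := Real.exp (-(T : ℝ)) with hε
    have hε0 : 0 < ε := Real.exp_pos _
    have hm : ∀ t : ℝ, 0 < max t ε := fun t => hε0.trans_le (le_max_right _ _)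
    have hcm : ∀ N, Continuous fun z => Real.log (max (f N z) ε) := fun N =>
      ((hf N).max continuous_const).log fun z => (hm _).ne'
    have key : Filter.Tendsto (fun N => Real.circleAverage (fun z => Real.log (max (f N z) ε)) c R)
        Filter.atTop (𝓝 (Real.circleAverage (fun z => Real.log (max (⨅ N, f N z) ε)) c R)) := by
      refine Filter.Tendsto.const_smul ?_ _
      refine intervalIntegral.tendsto_integral_filter_of_dominated_convergence
        (fun θ => |Real.log (max (f 0 (circleMap c R θ)) ε)| + |Real.log ε|) ?_ ?_ ?_ ?_
      · exact .of_forall fun N =>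
          ((hcm N).comp (continuous_circleMap c R)).aestronglyMeasurable
      · refine .of_forall fun N => .of_forall fun θ _ => ?_
        have h1 : Real.log ε ≤ Real.log (max (f N (circleMap c R θ)) ε) :=
          Real.log_le_log hε0 (le_max_right _ _)
        have h2 : Real.log (max (f N (circleMap c R θ)) ε)
            ≤ Real.log (max (f 0 (circleMap c R θ)) ε) :=
          Real.log_le_log (hm _) (max_le_max_right _ (hle _ _))
        rw [Real.norm_eq_abs, abs_le]
        constructor
        · linarith [neg_abs_le (Real.log ε), abs_nonneg (Real.log (max (f 0 (circleMap c R θ)) ε))]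
        · linarith [le_abs_self (Real.log (max (f 0 (circleMap c R θ)) ε)),
            abs_nonneg (Real.log ε)]
      · exact (((hcm 0).comp (continuous_circleMap c R)).abs.add
          continuous_const).intervalIntegrable _ _
      · refine .of_forall fun θ _ => ?_
        exact (((hlim _).max tendsto_const_nhds).log (hm _).ne')
    refine ge_of_tendsto key (.of_forall fun N => ?_)
    exact (Real.log_le_log hc (hgle N c)).trans
      ((hsub N c R hR).log_le_circleAverage (hf N) (hc.trans_le (hgle N c)) hε0)

theorem isHomogeneousPSH_log_iInf {X : Type*} [AddCommGroup X] [Module ℂ X] [TopologicalSpace X]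
    [IsTopologicalAddGroup X] [ContinuousSMul ℂ X]
    {f : ℕ → X → ℝ} (h0 : ∀ N x, 0 ≤ f N x) (hf : ∀ N, Continuous (f N))
    (hanti : ∀ N x, f (N + 1) x ≤ f N x) (hsmul : ∀ N (l : ℂ) x, f N (l • x) = ‖l‖ * f N x)
    (hsub : ∀ N (a b : X) c R, 0 < R → LogSubmeanAt (fun z => f N (a + z • b)) c R) :
    IsHomogeneousPSH fun x => ENNReal.log (ENNReal.ofReal (⨅ N, f N x)) where
  plurisubharmonic :=
    { upperSemicontinuousOn := (upperSemicontinuous_log_iInf h0 hf).upperSemicontinuousOn _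
      ne_top := fun x _ => by simp
      subharmonic := fun a b => by
        simpa only [Set.mem_univ, Set.ofPred_true] using
          isSubharmonicOn_log_iInf (f := fun N z => f N (a + z • b)) (fun N z => h0 N _)
            (fun N => (hf N).comp (by fun_prop)) (fun N z => hanti N _) fun N c R => hsub N a b c R }
  map_smul l x := by
    simp only [hsmul]
    rw [← Real.mul_iInf_of_nonneg (norm_nonneg l), ENNReal.ofReal_mul (norm_nonneg l),
      ENNReal.log_mul_add, ofReal_norm]

/-! ### Homogeneous polynomials on a normed space -/

/-- `Q` is a continuous function on `X` which is homogeneous of degree `k`, entire along every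
complex line, and bounded by `M` on the unit ball. -/
structure IsBoundedHomogeneous {X : Type*} [NormedAddCommGroup X] [NormedSpace ℂ X]
    (k : ℕ) (M : ℝ) (Q : X → ℂ) : Prop where
  continuous : Continuous Q
  map_smul : ∀ (l : ℂ) (x : X), Q (l • x) = l ^ k * Q x
  differentiable_line : ∀ a b : X, Differentiable ℂ fun z : ℂ => Q (a + z • b)
  norm_le : ∀ x, ‖Q x‖ ≤ M * ‖x‖ ^ k

namespace IsBoundedHomogeneous

variable {X : Type*} [NormedAddCommGroup X] [NormedSpace ℂ X] {k : ℕ} {M : ℝ} {Q : X → ℂ}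

theorem inv_mul (hQ : IsBoundedHomogeneous k M Q) (hM : 0 < M) :
    IsBoundedHomogeneous k 1 fun x => (M : ℂ)⁻¹ * Q x where
  continuous := hQ.continuous.const_mul _
  map_smul l x := by rw [hQ.map_smul]; ring
  differentiable_line a b := (hQ.differentiable_line a b).const_mul _
  norm_le x := by
    rw [norm_mul, norm_inv, Complex.norm_real, Real.norm_of_nonneg hM.le, inv_mul_le_iff₀ hM,
      one_mul]
    exact hQ.norm_le x

/-- The maximum principle for `η ↦ Q (η • a + w)`: on every ball of radius `r` the polynomial `Q`
is somewhere at least `r ^ k` times its value at a given point of the unit ball. -/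
theorem exists_pow_mul_norm_le (hQ : IsBoundedHomogeneous k M Q) (a : X) {w : X} (hw : ‖w‖ ≤ 1)
    {r : ℝ} (hr : 0 < r) : ∃ b, ‖b - a‖ ≤ r ∧ r ^ k * ‖Q w‖ ≤ ‖Q b‖ := by
  by_contra! hcon
  obtain ⟨η, hη, hmax⟩ := Complex.exists_mem_frontier_isMaxOn_norm
    (f := fun z : ℂ => Q (w + z • a)) (U := Metric.ball 0 r⁻¹) Metric.isBounded_ball
    ⟨0, Metric.mem_ball_self (by positivity)⟩ (hQ.differentiable_line w a).diffContOnCl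
  have h0 := hmax (subset_closure (Metric.mem_ball_self (by positivity)))
  simp only [Set.mem_ofPred_eq, Function.comp_apply, zero_smul, add_zero] at h0
  rw [frontier_ball _ (by positivity), mem_sphere_zero_iff_norm] at hη
  have hη0 : η ≠ 0 := by
    rintro rfl
    rw [norm_zero] at hη
    exact (inv_pos.mpr hr).ne hη
  -- The maximum is attained at some `|η| = r⁻¹`; homogeneity moves it to `b = a + η⁻¹ • w`, at
  -- distance at most `r` from `a`.
  have h1 := hcon (a + η⁻¹ • w) (by
    rw [add_sub_cancel_left, norm_smul, norm_inv, hη, inv_inv]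
    exact mul_le_of_le_one_right hr.le hw)
  have h2 : Q (w + η • a) = η ^ k * Q (a + η⁻¹ • w) := by
    rw [← hQ.map_smul, smul_add, smul_inv_smul₀ hη0, add_comm]
  rw [h2, norm_mul, norm_pow, hη, inv_pow] at h0
  rw [le_inv_mul_iff₀ (by positivity)] at h0
  exact absurd h0 (not_le.mpr h1)

end IsBoundedHomogeneous

/-! ### Weighted geometric means of homogeneous polynomials -/

section

variable {X : Type*} [NormedAddCommGroup X]

/-- The product of the `‖p j x‖ ^ (c j / d j)` over `j < N`, where `d j` is the degree of `p j`,
completed by a power of the norm so as to be homogeneous of degree one. -/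
noncomputable def weightedMean (p : ℕ → X → ℂ) (d : ℕ → ℕ) (c : ℕ → ℝ) (N : ℕ) (x : X) : ℝ :=
  (∏ j ∈ Finset.range N, ‖p j x‖ ^ (c j / d j)) * ‖x‖ ^ (1 - ∑ j ∈ Finset.range N, c j)

variable {p : ℕ → X → ℂ} {d : ℕ → ℕ} {c : ℕ → ℝ}

theorem weightedMean_nonneg (N : ℕ) (x : X) : 0 ≤ weightedMean p d c N x := by
  unfold weightedMean; positivity

theorem isHomogeneousPSH_weightedMean [NormedSpace ℂ X]
    (hp : ∀ j, IsBoundedHomogeneous (d j) 1 (p j))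
    (hd : ∀ j, 1 ≤ d j) (hc : ∀ j, 0 < c j) (hs : ∀ N, ∑ j ∈ Finset.range N, c j < 1) :
    IsHomogeneousPSH fun x => ENNReal.log (ENNReal.ofReal (⨅ N, weightedMean p d c N x)) := by
  have hd0 : ∀ j, (0 : ℝ) < d j := fun j => by exact_mod_cast hd j
  have hcd : ∀ j, 0 < c j / d j := fun j => div_pos (hc j) (hd0 j)
  have hpow : ∀ (t : ℝ) j, 0 ≤ t → (t ^ d j) ^ (c j / d j) = t ^ c j := fun t j ht => by
    rw [← Real.rpow_natCast, ← Real.rpow_mul ht, mul_div_cancel₀ _ (hd0 j).ne']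
  refine isHomogeneousPSH_log_iInf weightedMean_nonneg (fun N => ?_) (fun N x => ?_)
    (fun N l x => ?_) fun N a b ζ R hR => ?_
  · refine (continuous_finsetProd _ fun j _ => ?_).mul ?_
    · exact (hp j).continuous.norm.rpow_const fun _ => .inr (hcd j).le
    · exact continuous_norm.rpow_const fun _ => .inr (sub_nonneg.mpr (hs N).le)
  -- The new factor is at most `‖x‖ ^ c N`, which is exactly what is taken from the power of the
  -- norm.
  · have h1 : ‖p N x‖ ^ (c N / d N) ≤ ‖x‖ ^ c N := by
      rw [← hpow _ _ (norm_nonneg x)]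
      have := (hp N).norm_le x
      rw [one_mul] at this
      exact Real.rpow_le_rpow (norm_nonneg _) this (hcd N).le
    have h2 : ‖x‖ ^ (1 - ∑ j ∈ Finset.range N, c j)
        = ‖x‖ ^ c N * ‖x‖ ^ (1 - ∑ j ∈ Finset.range (N + 1), c j) := by
      have h3 : c N + (1 - ∑ j ∈ Finset.range (N + 1), c j) = 1 - ∑ j ∈ Finset.range N, c j := by
        rw [Finset.sum_range_succ]; ring
      rw [← Real.rpow_add' (norm_nonneg x), h3]
      rw [h3]
      exact (sub_pos.mpr (hs N)).ne'
    unfold weightedMean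
    rw [h2, Finset.prod_range_succ, mul_assoc]
    gcongr
  · have h1 : ∀ j, ‖p j (l • x)‖ ^ (c j / d j) = ‖l‖ ^ c j * ‖p j x‖ ^ (c j / d j) := fun j => by
      rw [(hp j).map_smul, norm_mul, norm_pow, Real.mul_rpow (by positivity) (by positivity),
        hpow _ _ (norm_nonneg l)]
    unfold weightedMean
    simp only [h1]
    rw [Finset.prod_mul_distrib, ← Real.rpow_sum_of_nonneg (norm_nonneg l) fun j _ => (hc j).le,
      norm_smul, Real.mul_rpow (norm_nonneg _) (norm_nonneg _)]
    have h2 : ‖l‖ ^ (∑ j ∈ Finset.range N, c j) * ‖l‖ ^ (1 - ∑ j ∈ Finset.range N, c j) = ‖l‖ := by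
      rw [← Real.rpow_add' (norm_nonneg l) (by simp), add_sub_cancel, Real.rpow_one]
    nth_rewrite 3 [← h2]
    ring
  · refine .mul (.prod _ (fun j _ => .rpow (.norm_of_differentiable
      ((hp j).differentiable_line a b) hR) (norm_nonneg _) (hcd j)) fun j _ => by positivity)
      (.rpow (.norm_add_smul a b hR) (norm_nonneg _) (sub_pos.mpr (hs N))) ?_ (by positivity)
    exact Finset.prod_nonneg fun j _ => by positivity

theorem iInf_weightedMean_pos {x : X} (hx : x ≠ 0) {r : ℕ → ℝ} {S : ℝ}
    (hc : ∀ j, 0 < c j) (hs : ∀ N, ∑ j ∈ Finset.range N, c j < 1)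
    (hr : ∀ j, Real.exp (-r j) ≤ ‖p j x‖ ^ (c j / d j))
    (hS : ∀ N, ∑ j ∈ Finset.range N, r j ≤ S) : 0 < ⨅ N, weightedMean p d c N x := by
  have hx0 : 0 < ‖x‖ := norm_pos_iff.mpr hx
  have hm : 0 < min ‖x‖ 1 := lt_min hx0 one_pos
  refine (mul_pos (Real.exp_pos (-S)) hm).trans_le (le_ciInf fun N => ?_)
  have hs0 : 0 ≤ ∑ j ∈ Finset.range N, c j := Finset.sum_nonneg fun j _ => (hc j).le
  refine mul_le_mul ?_ ?_ hm.le (by positivity)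
  · calc Real.exp (-S) ≤ Real.exp (∑ j ∈ Finset.range N, -r j) := by
          rw [Real.exp_le_exp, Finset.sum_neg_distrib]
          exact neg_le_neg (hS N)
      _ = ∏ j ∈ Finset.range N, Real.exp (-r j) := Real.exp_sum _ _
      _ ≤ _ := Finset.prod_le_prod (fun j _ => (Real.exp_pos _).le) fun j _ => hr j
  · calc min ‖x‖ 1 = min ‖x‖ 1 ^ (1 : ℝ) := (Real.rpow_one _).symm
      _ ≤ min ‖x‖ 1 ^ (1 - ∑ j ∈ Finset.range N, c j) :=
        Real.rpow_le_rpow_of_exponent_ge hm (min_le_right _ _) (by linarith)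
      _ ≤ _ := Real.rpow_le_rpow hm.le (min_le_left _ _) (sub_nonneg.mpr (hs N).le)

theorem iInf_weightedMean_eq_zero {x : X} (hc : ∀ j, 0 < c j)
    (hs : ∀ N, ∑ j ∈ Finset.range N, c j < 1) {q : ℝ} (hq : q < 1)
    (hx : ∀ᶠ j in Filter.atTop, ‖p j x‖ ^ (c j / d j) ≤ q) : ⨅ N, weightedMean p d c N x = 0 := by
  obtain ⟨J, hJ⟩ := Filter.eventually_atTop.mp hx
  have hq0 : 0 ≤ q := (by positivity : 0 ≤ ‖p J x‖ ^ (c J / d J)).trans (hJ J le_rfl)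
  set K := (∏ j ∈ Finset.range J, ‖p j x‖ ^ (c j / d j)) * max ‖x‖ 1 with hK
  have hbd : ∀ N, weightedMean p d c (J + N) x ≤ K * q ^ N := fun N => by
    have hs0 : 0 ≤ ∑ j ∈ Finset.range (J + N), c j := Finset.sum_nonneg fun j _ => (hc j).le
    have h1 : ‖x‖ ^ (1 - ∑ j ∈ Finset.range (J + N), c j) ≤ max ‖x‖ 1 :=
      calc _ ≤ max ‖x‖ 1 ^ (1 - ∑ j ∈ Finset.range (J + N), c j) :=
            Real.rpow_le_rpow (norm_nonneg x) (le_max_left _ _) (sub_nonneg.mpr (hs _).le)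
        _ ≤ max ‖x‖ 1 ^ (1 : ℝ) :=
            Real.rpow_le_rpow_of_exponent_le (le_max_right _ _) (by linarith)
        _ = _ := Real.rpow_one _
    have h2 : ∏ i ∈ Finset.range N, ‖p (J + i) x‖ ^ (c (J + i) / d (J + i)) ≤ q ^ N := by
      calc _ ≤ ∏ i ∈ Finset.range N, q :=
            Finset.prod_le_prod (fun i _ => by positivity) fun i _ => hJ _ (Nat.le_add_right _ _)
        _ = q ^ N := by simp
    have h3 : 0 ≤ ∏ j ∈ Finset.range J, ‖p j x‖ ^ (c j / d j) :=
      Finset.prod_nonneg fun j _ => by positivity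
    unfold weightedMean
    rw [Finset.prod_range_add, hK, mul_assoc, mul_assoc, mul_comm (max _ _)]
    exact mul_le_mul_of_nonneg_left (mul_le_mul h2 h1 (by positivity) (by positivity)) h3
  have hlim : Filter.Tendsto (fun N => K * q ^ N) Filter.atTop (𝓝 0) := by
    simpa using (tendsto_pow_atTop_nhds_zero_of_lt_one hq0 hq).const_mul K
  refine le_antisymm (ge_of_tendsto hlim (.of_forall fun N => ?_))
    (Real.iInf_nonneg fun N => weightedMean_nonneg N x)
  exact (ciInf_le ⟨0, by rintro _ ⟨N, rfl⟩; exact weightedMean_nonneg N x⟩ (J + N)).trans (hbd N)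

end

/-! ### Families of polynomials which grow too fast on the unit ball -/

section

variable {X : Type*} [NormedAddCommGroup X] [NormedSpace ℂ X]

theorem isProjectivelyPluripolar_empty [Nontrivial X] :
    IsProjectivelyPluripolar (∅ : Set X) := by
  obtain ⟨x, hx⟩ := exists_ne (0 : X)
  refine ⟨_, isHomogeneousPSH_log_iInf (f := fun _ (x : X) => ‖x‖) (fun _ x => norm_nonneg x)
    (fun _ => continuous_norm) (fun _ _ => le_rfl) (fun _ l x => norm_smul l x)
    (fun _ a b c R hR => .norm_add_smul a b hR), ⟨x, ?_⟩, by simp⟩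
  simpa using hx

variable {Q : ℕ → X → ℂ} {k : ℕ → ℕ} {M : ℕ → ℝ}

/-- The maximum principle at radius `r / 2` gives a centre with `|Q n| ≥ (r / 2) ^ k n * M n`.
Weakening to `r / 4` makes this strict, as `k n ≥ 1`, hence stable on a small ball. -/
theorem exists_closedBall_subset_and_lt_norm
    (hQ : ∀ n, 1 ≤ n → IsBoundedHomogeneous (k n) (M n) (Q n))
    (hatt : ∀ n, 1 ≤ n → ∃ w, ‖w‖ ≤ 1 ∧ ‖Q n w‖ = M n)
    (hM : ∀ C : ℝ, ∃ n, 1 ≤ n ∧ 1 ≤ k n ∧ Real.exp (C * n) < M n)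
    (z : X) {r : ℝ} (hr : 0 < r) : ∃ n z' r', 1 ≤ n ∧ 1 ≤ k n ∧ 0 < r' ∧ r' ≤ r / 2 ∧
      Metric.closedBall z' r' ⊆ Metric.closedBall z r ∧ Real.exp (4 / r ^ 2 * n) < M n ∧
      ∀ y ∈ Metric.closedBall z' r', (r / 4) ^ k n * M n < ‖Q n y‖ := by
  obtain ⟨n, hn, hk, hn'⟩ := hM (4 / r ^ 2)
  have hM0 : 0 < M n := (Real.exp_pos _).trans hn'
  obtain ⟨w, hw, hwM⟩ := hatt n hn
  obtain ⟨z', hz', hle⟩ := (hQ n hn).exists_pow_mul_norm_le z hw (half_pos hr)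
  have hlt : (r / 4) ^ k n * M n < ‖Q n z'‖ := by
    refine lt_of_lt_of_le ?_ hle
    rw [hwM]
    exact mul_lt_mul_of_pos_right (pow_lt_pow_left₀ (by linarith) (by positivity) (by lia)) hM0
  obtain ⟨δ, hδ, hball⟩ := Metric.nhds_basis_closedBall.mem_iff.mp
    ((hQ n hn).continuous.norm.continuousAt.eventually_const_lt hlt)
  refine ⟨n, z', min δ (r / 2), hn, hk, lt_min hδ (half_pos hr), min_le_right _ _, ?_, hn',
    fun y hy => hball (Metric.closedBall_subset_closedBall (min_le_left _ _) hy)⟩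
  refine Metric.closedBall_subset_closedBall' ?_
  rw [dist_eq_norm]
  linarith [min_le_right δ (r / 2)]

/-- The inductive construction of the nested balls and of `φ`; `hball` provides the point where `φ`
is finite. -/
theorem isProjectivelyPluripolar_of_exp_lt
    (hball : ∀ (z : ℕ → X) (r : ℕ → ℝ), (∀ j, 0 < r j) →
      (∀ j, Metric.closedBall (z (j + 1)) (r (j + 1)) ⊆ Metric.closedBall (z j) (r j)) →
      ∃ x, ∀ j, x ∈ Metric.closedBall (z j) (r j))
    (hQ : ∀ n, 1 ≤ n → IsBoundedHomogeneous (k n) (M n) (Q n)) (hkn : ∀ n, 1 ≤ n → k n ≤ n)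
    (hatt : ∀ n, 1 ≤ n → ∃ w, ‖w‖ ≤ 1 ∧ ‖Q n w‖ = M n)
    (hM : ∀ C : ℝ, ∃ n, 1 ≤ n ∧ 1 ≤ k n ∧ Real.exp (C * n) < M n) :
    IsProjectivelyPluripolar {x : X | ∃ C : ℝ, ∀ n, 1 ≤ n → ‖Q n x‖ ≤ Real.exp (C * n)} := by
  choose ν z' r' hν hkν hr' hr'2 hsub hMν hlow using
    fun (s : X × Set.Ioi (0 : ℝ)) => exists_closedBall_subset_and_lt_norm hQ hatt hM s.1 s.2.2
  let s : ℕ → X × Set.Ioi (0 : ℝ) :=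
    fun j => j.rec (0, ⟨1 / 2, by norm_num⟩) fun _ s => (z' s, ⟨r' s, hr' s⟩)
  have hs0 : ((s 0).2 : ℝ) = 1 / 2 := rfl
  have hs1 : ∀ j, ((s (j + 1)).2 : ℝ) = r' (s j) := fun j => rfl
  set r : ℕ → ℝ := fun j => (s j).2 with hr
  set n : ℕ → ℕ := fun j => ν (s j)
  have hr0 : ∀ j, 0 < r j := fun j => (s j).2.2
  have hrle : ∀ j, r j ≤ 1 / 2 * (1 / 2) ^ j := fun j => by
    induction j with
    | zero => simp [hr, hs0]
    | succ j ih =>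
      have := hr'2 (s j)
      rw [← hs1] at this
      rw [pow_succ]
      change r (j + 1) ≤ r j / 2 at this
      linarith
  have hrsum : ∀ N, ∑ j ∈ Finset.range N, r j ≤ 1 := fun N => by
    have h1 : ∑ j ∈ Finset.range N, (1 / 2 : ℝ) * (1 / 2) ^ j = 1 - (1 / 2) ^ N := by
      rw [← Finset.mul_sum, geom_sum_eq (by norm_num)]
      ring
    calc _ ≤ ∑ j ∈ Finset.range N, (1 / 2 : ℝ) * (1 / 2) ^ j := Finset.sum_le_sum fun j _ => hrle j
      _ ≤ 1 := by rw [h1]; linarith [pow_pos (one_half_pos (α := ℝ)) N]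
  have hr1 : ∀ j, r j ≤ 1 := fun j => (hrle j).trans (by
    linarith [pow_le_one₀ (n := j) (one_half_pos (α := ℝ)).le one_half_lt_one.le])
  -- Two identities are wanted: `c j * (4 / r j) = r j`, summable, for the lower bound at `x`; and
  -- `c j * (4 / r j ^ 2) = 1`, for the decay on the bounded set.
  set c : ℕ → ℝ := fun j => r j ^ 2 / 4 with hcdef
  have hc : ∀ j, 0 < c j := fun j => by have := hr0 j; positivity
  have hcs : ∀ N, ∑ j ∈ Finset.range N, c j < 1 := fun N => by
    calc _ ≤ ∑ j ∈ Finset.range N, 1 / 4 * r j := Finset.sum_le_sum fun j _ => by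
          have := mul_le_mul_of_nonneg_left (hr1 j) (hr0 j).le
          simp only [hcdef]; linarith [sq (r j)]
      _ < 1 := by rw [← Finset.mul_sum]; linarith [hrsum N]
  have hMpos : ∀ j, 0 < M (n j) := fun j => (Real.exp_pos _).trans (hMν (s j))
  set p : ℕ → X → ℂ := fun j x => ((M (n j) : ℝ) : ℂ)⁻¹ * Q (n j) x with hpdef
  have hp : ∀ j, IsBoundedHomogeneous (k (n j)) 1 (p j) := fun j =>
    (hQ _ (hν _)).inv_mul (hMpos j)
  have hpn : ∀ j x, ‖p j x‖ = ‖Q (n j) x‖ / M (n j) := fun j x => by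
    rw [hpdef, norm_mul, norm_inv, Complex.norm_real, Real.norm_of_nonneg (hMpos j).le]
    ring
  have hd0 : ∀ j, (0 : ℝ) < k (n j) := fun j => by exact_mod_cast hkν (s j)
  have hcd : ∀ j, 0 < c j / k (n j) := fun j => div_pos (hc j) (hd0 j)
  obtain ⟨x, hx⟩ := hball (fun j => (s j).1) r hr0 fun j => hsub (s j)
  have hxlow : ∀ j, (r j / 4) ^ k (n j) < ‖p j x‖ := fun j => by
    rw [hpn, lt_div_iff₀ (hMpos j)]
    exact hlow (s j) x (hx (j + 1))
  refine ⟨_, isHomogeneousPSH_weightedMean hp (fun j => hkν (s j)) hc hcs, ⟨x, ?_⟩, ?_⟩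
  · have hx0 : x ≠ 0 := by
      rintro rfl
      have h1 := hxlow 0
      have h2 := (hp 0).map_smul 0 0
      rw [zero_pow (by have := hkν (s 0); change k (n 0) ≠ 0; lia), smul_zero, zero_mul] at h2
      rw [h2, norm_zero] at h1
      have := hr0 0
      exact absurd h1 (not_lt.mpr (by positivity))
    have hpos := iInf_weightedMean_pos (p := p) (d := fun j => k (n j)) hx0 hc hcs (r := r)
      (fun j => ?_) hrsum
    · rw [ENNReal.log_ofReal_of_pos hpos]
      exact EReal.coe_ne_bot _
    · have h4 : 0 < r j / 4 := by linarith [hr0 j]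
      calc Real.exp (-r j) ≤ (r j / 4) ^ c j := by
            rw [Real.rpow_def_of_pos h4, Real.exp_le_exp]
            -- Hence `c j * log (r j / 4) ≥ c j - r j ≥ -r j`.
            have h5 : 1 - (r j / 4)⁻¹ ≤ Real.log (r j / 4) := Real.one_sub_inv_le_log_of_pos h4
            have h6 : c j * (r j / 4)⁻¹ = r j := by
              have := (hr0 j).ne'
              simp only [hcdef]; field_simp
            have h7 := mul_le_mul_of_nonneg_left h5 (hc j).le
            rw [mul_sub, h6] at h7
            linarith [hc j]
        _ = ((r j / 4) ^ k (n j)) ^ (c j / k (n j)) := by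
            rw [← Real.rpow_natCast, ← Real.rpow_mul h4.le, mul_div_cancel₀ _ (hd0 j).ne']
        _ ≤ _ := Real.rpow_le_rpow (by positivity) (hxlow j).le (hcd j).le
  · rintro y ⟨C, hC⟩
    have hrlim : Filter.Tendsto r Filter.atTop (𝓝 0) :=
      squeeze_zero (fun j => (hr0 j).le) hrle (by
        simpa only [mul_zero] using (tendsto_pow_atTop_nhds_zero_of_lt_one
          (one_half_pos (α := ℝ)).le one_half_lt_one).const_mul (1 / 2))
    have hclim : Filter.Tendsto (fun j => c j * C) Filter.atTop (𝓝 0) := by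
      simpa using ((hrlim.pow 2).div_const 4).mul_const C
    have h0 := iInf_weightedMean_eq_zero (p := p) (d := fun j => k (n j)) (x := y) hc hcs
      (q := Real.exp (-(1 / 2))) (by rw [Real.exp_lt_one_iff]; norm_num) ?_
    · simp [h0]
    filter_upwards [hclim.eventually_lt_const one_half_pos] with j hj
    have hcj : c j * (4 / r j ^ 2) = 1 := by
      have := (hr0 j).ne'
      simp only [hcdef]; field_simp
    have h1 : ‖p j y‖ ≤ Real.exp ((C - 4 / r j ^ 2) * n j) := by
      rw [hpn, div_le_iff₀ (hMpos j), sub_mul, Real.exp_sub, div_mul_eq_mul_div,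
        le_div_iff₀ (Real.exp_pos _)]
      exact mul_le_mul (hC _ (hν _)) (hMν (s j)).le (Real.exp_pos _).le (Real.exp_pos _).le
    -- The exponent `c j * C - 1` is below `-1/2`, so a ratio `n j / k (n j) ≥ 1` only improves the
    -- bound.
    have hnk : 1 ≤ (n j : ℝ) / k (n j) := by
      rw [one_le_div (hd0 j)]
      exact_mod_cast hkn _ (hν _)
    calc _ ≤ Real.exp ((C - 4 / r j ^ 2) * n j) ^ (c j / k (n j)) :=
          Real.rpow_le_rpow (norm_nonneg _) h1 (hcd j).le
      _ = Real.exp ((c j * C - c j * (4 / r j ^ 2)) * (n j / k (n j))) := by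
          rw [← Real.exp_mul]; ring_nf
      _ ≤ _ := by
          rw [hcj, Real.exp_le_exp]
          nlinarith

end

/-! ### The unit ball of `E_B` -/

namespace DiskHull

variable {E : Type*} [AddCommGroup E] [Module ℂ E] [TopologicalSpace E]
  {B : Set E} (hB : IsCompactDisk B)

theorem incl_injective : Function.Injective (incl hB) := Submodule.subtype_injective _

theorem exists_incl_eq {b : E} (hb : b ∈ B) : ∃ x : DiskHull hB, ‖x‖ ≤ 1 ∧ incl hB x = b :=
  ⟨(⟨b, Submodule.subset_span hb⟩ : Submodule.span ℂ B), gauge_le_one_of_mem hb, rfl⟩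

variable [IsTopologicalAddGroup E] [ContinuousSMul ℂ E] [T2Space E]

theorem incl_mem_of_norm_lt_one {x : DiskHull hB} (hx : ‖x‖ < 1) : incl hB x ∈ B := by
  have h0 : (0 : DiskHull hB) ∈ incl hB ⁻¹' B := by
    simpa using hB.balanced.zero_mem hB.nonempty
  rw [← gauge_preimage] at hx
  exact setOfPred_gauge_lt_one_subset_self (convex_preimage hB) h0 (absorbent_preimage hB) hx

/-- `B` is closed and contains `t • x` for all `t < 1` close to `1`. -/
theorem incl_mem_of_norm_le_one {x : DiskHull hB} (hx : ‖x‖ ≤ 1) : incl hB x ∈ B := by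
  have hlim : Filter.Tendsto (fun t : ℝ => (t : ℂ) • incl hB x) (𝓝[<] 1) (𝓝 (incl hB x)) := by
    have : Continuous fun t : ℝ => (t : ℂ) • incl hB x := by fun_prop
    simpa using (this.tendsto 1).mono_left nhdsWithin_le_nhds
  refine hB.isCompact.isClosed.mem_of_tendsto hlim ?_
  filter_upwards [Ioo_mem_nhdsLT (zero_lt_one (α := ℝ))] with t ht
  rw [← map_smul]
  refine incl_mem_of_norm_lt_one hB ?_
  rw [norm_smul, Complex.norm_real, Real.norm_of_nonneg ht.1.le]
  nlinarith [ht.1, ht.2]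

theorem continuous_incl : Continuous (incl hB) := by
  have h : ∃ V ∈ 𝓝 (0 : DiskHull hB), Bornology.IsVonNBounded ℂ (incl hB '' V) := by
    refine ⟨_, Metric.closedBall_mem_nhds 0 one_pos,
      (hB.isCompact.isVonNBounded ℂ).subset ?_⟩
    rintro _ ⟨x, hx, rfl⟩
    exact incl_mem_of_norm_le_one hB (mem_closedBall_zero_iff.mp hx)
  exact ((incl hB).clmOfExistsBoundedImage h).continuous

theorem image_closedBall (z : DiskHull hB) {r : ℝ} (hr : 0 < r) :
    incl hB '' Metric.closedBall z r = (fun b => incl hB z + (r : ℂ) • b) '' B := by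
  have hr' : (r : ℂ) ≠ 0 := by exact_mod_cast hr.ne'
  ext e
  constructor
  · rintro ⟨x, hx, rfl⟩
    rw [Metric.mem_closedBall, dist_eq_norm] at hx
    refine ⟨incl hB ((r : ℂ)⁻¹ • (x - z)), incl_mem_of_norm_le_one hB ?_, ?_⟩
    · rw [norm_smul, norm_inv, Complex.norm_real, Real.norm_of_nonneg hr.le,
        inv_mul_le_iff₀ hr, mul_one]
      exact hx
    · simp [hr']
  · rintro ⟨b, hb, rfl⟩
    obtain ⟨x, hx, rfl⟩ := exists_incl_eq hB hb
    refine ⟨z + (r : ℂ) • x, ?_, by simp⟩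
    rw [Metric.mem_closedBall, dist_eq_norm, add_sub_cancel_left, norm_smul, Complex.norm_real,
      Real.norm_of_nonneg hr.le]
    exact mul_le_of_le_one_right hr.le hx

theorem isCompact_image_closedBall (z : DiskHull hB) {r : ℝ} (hr : 0 < r) :
    IsCompact (incl hB '' Metric.closedBall z r) := by
  rw [image_closedBall hB z hr]
  exact hB.isCompact.image (by fun_prop)

/-- Decreasing sequences of closed balls of `E_B` have a common point, because the closed balls are
compact in `E`. -/
theorem exists_forall_mem_closedBall (z : ℕ → DiskHull hB) (r : ℕ → ℝ) (hr : ∀ j, 0 < r j)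
    (hsub : ∀ j, Metric.closedBall (z (j + 1)) (r (j + 1)) ⊆ Metric.closedBall (z j) (r j)) :
    ∃ x, ∀ j, x ∈ Metric.closedBall (z j) (r j) := by
  obtain ⟨e, he⟩ := IsCompact.nonempty_iInter_of_sequence_nonempty_isCompact_isClosed
    (fun j => incl hB '' Metric.closedBall (z j) (r j)) (fun j => Set.image_mono (hsub j))
    (fun j => ⟨_, Set.mem_image_of_mem _ (Metric.mem_closedBall_self (hr j).le)⟩)
    (isCompact_image_closedBall hB _ (hr 0))
    fun j => (isCompact_image_closedBall hB _ (hr j)).isClosed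
  rw [Set.mem_iInter] at he
  obtain ⟨x, -, hx⟩ := he 0
  refine ⟨x, fun j => ?_⟩
  obtain ⟨y, hy, hyx⟩ := he j
  rwa [← incl_injective hB (hyx.trans hx.symm)]

end DiskHull

/-! ### Polynomials on `E` restricted to `E_B` -/

namespace IsContinuousHomogeneousPolynomial

variable {E : Type*} [AddCommGroup E] [Module ℂ E] [TopologicalSpace E] {k : ℕ} {P : E → ℂ}

theorem map_smul (hP : IsContinuousHomogeneousPolynomial k P) (l : ℂ) (x : E) :
    P (l • x) = l ^ k * P x := by
  obtain ⟨m, hm⟩ := hP.exists_multilinear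
  rw [hm, hm, m.map_smul_univ (fun _ => l) fun _ => x]
  simp

theorem differentiable_line (hP : IsContinuousHomogeneousPolynomial k P) (a b : E) :
    Differentiable ℂ fun z : ℂ => P (a + z • b) := by
  obtain ⟨m, hm⟩ := hP.exists_multilinear
  have h : ∀ z : ℂ, P (a + z • b) = ∑ s : Finset (Fin k),
      (∏ i, if i ∈ s then 1 else z) * m (s.piecewise (fun _ => a) fun _ => b) := fun z => by
    rw [hm]
    change m ((fun _ => a) + fun _ => z • b) = _
    rw [m.map_add_univ]
    refine Finset.sum_congr rfl fun s _ => ?_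
    rw [← smul_eq_mul, ← m.map_smul_univ]
    congr 1
    ext i
    by_cases hi : i ∈ s <;> simp [hi]
  simp only [h]
  refine .fun_sum fun s _ => .mul_const ?_ _
  simp only [Finset.prod_ite, Finset.prod_const_one, Finset.prod_const, one_mul]
  fun_prop

variable [IsTopologicalAddGroup E] [ContinuousSMul ℂ E] [T2Space E] {B : Set E}

theorem isBoundedHomogeneous (hP : IsContinuousHomogeneousPolynomial k P) (hB : IsCompactDisk B)
    {M : ℝ} (hM : ∀ b ∈ B, ‖P b‖ ≤ M) :
    IsBoundedHomogeneous k M fun x => P (DiskHull.incl hB x) where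
  continuous := hP.continuous.comp (DiskHull.continuous_incl hB)
  map_smul l x := by rw [_root_.map_smul, hP.map_smul]
  differentiable_line a b := by
    simpa only [map_add, _root_.map_smul] using hP.differentiable_line _ _
  norm_le x := by
    rcases eq_or_ne x 0 with rfl | hx
    · have h := hM _ (hB.balanced.zero_mem hB.nonempty)
      have h1 := hP.map_smul 0 0
      rw [smul_zero] at h1
      rw [map_zero, norm_zero, h1, norm_mul, norm_pow, norm_zero, mul_comm]
      gcongr
    · have hx0 : 0 < ‖x‖ := norm_pos_iff.mpr hx
      have hx1 : ((‖x‖ : ℝ) : ℂ) ≠ 0 := by exact_mod_cast hx0.ne'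
      have hb : DiskHull.incl hB (((‖x‖ : ℝ) : ℂ)⁻¹ • x) ∈ B := by
        refine DiskHull.incl_mem_of_norm_le_one hB ?_
        rw [norm_smul, norm_inv, Complex.norm_real, norm_norm, inv_mul_cancel₀ hx0.ne']
      have h := hM _ hb
      rw [_root_.map_smul, hP.map_smul, norm_mul, norm_pow, norm_inv, Complex.norm_real, norm_norm,
        inv_pow, inv_mul_le_iff₀ (by positivity), mul_comm] at h
      exact h

end IsContinuousHomogeneousPolynomial

/-! ### Exponential bounds and the main theorem -/

theorem logRoot_le_coe_iff {E : Type*} {n : ℕ} (hn : 1 ≤ n) (P : E → ℂ) (z : E) (C : ℝ) :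
    logRoot n P z ≤ (C : EReal) ↔ ‖P z‖ ≤ Real.exp (C * n) := by
  have hn0 : (0 : ℝ) < n := by exact_mod_cast hn
  unfold logRoot
  rw [← ofReal_norm]
  rcases (norm_nonneg (P z)).eq_or_lt with h | h
  · rw [← h, ENNReal.ofReal_zero, ENNReal.log_zero, EReal.coe_mul_bot_of_pos (by positivity)]
    simp [(Real.exp_pos _).le]
  · rw [ENNReal.log_ofReal_of_pos h, ← EReal.coe_mul, EReal.coe_le_coe_iff, inv_mul_le_iff₀ hn0,
      Real.log_le_iff_le_exp h, mul_comm]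

theorem mainTheorem4 {E : Type*} [AddCommGroup E] [Module ℂ E] [UniformSpace E]
    [IsUniformAddGroup E] [ContinuousSMul ℂ E] [LocallyConvexSpace ℝ E] [T2Space E]
    [FirstCountableTopology E] [CompleteSpace E]
    {B : Set E} (hB : IsCompactDisk B) (hB0 : ∃ b ∈ B, b ≠ 0)
    (P : ℕ → E → ℂ)
    (hP : ∀ n : ℕ, 1 ≤ n → ∃ k ≤ n, IsContinuousHomogeneousPolynomial k (P n))
    (hA : ¬ IsProjectivelyPluripolar
      {z : DiskHull hB | (⨆ n : ℕ, ⨆ _ : 1 ≤ n, logRoot n (P n) (DiskHull.incl hB z)) < ⊤}) :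
    LocallyUniformlyBddAbove
      (fun (n : ℕ) (z : DiskHull hB) => logRoot n (P n) (DiskHull.incl hB z)) := by
  have : Nontrivial (DiskHull hB) := by
    obtain ⟨b, hb, hb0⟩ := hB0
    obtain ⟨x, -, rfl⟩ := DiskHull.exists_incl_eq hB hb
    exact nontrivial_of_ne x 0 fun h => hb0 (by rw [h, map_zero])
  choose! k hkn hP using hP
  have hmax : ∀ n, 1 ≤ n → ∃ b ∈ B, ∀ y ∈ B, ‖P n y‖ ≤ ‖P n b‖ := fun n hn =>
    hB.isCompact.exists_isMaxOn hB.nonempty (hP n hn).continuous.norm.continuousOn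
  choose! b hbB hb using hmax
  have hQ : ∀ n, 1 ≤ n → IsBoundedHomogeneous (k n) ‖P n (b n)‖
      fun x : DiskHull hB => P n (DiskHull.incl hB x) := fun n hn =>
    (hP n hn).isBoundedHomogeneous hB (hb n hn)
  have hatt : ∀ n, 1 ≤ n → ∃ w : DiskHull hB, ‖w‖ ≤ 1 ∧ ‖P n (DiskHull.incl hB w)‖ = ‖P n (b n)‖ :=
    fun n hn => by
      obtain ⟨w, hw, hwb⟩ := DiskHull.exists_incl_eq hB (hbB n hn)
      exact ⟨w, hw, by rw [hwb]⟩
  have hAset : {z : DiskHull hB |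
      (⨆ n : ℕ, ⨆ _ : 1 ≤ n, logRoot n (P n) (DiskHull.incl hB z)) < ⊤} =
      {z | ∃ C : ℝ, ∀ n, 1 ≤ n → ‖P n (DiskHull.incl hB z)‖ ≤ Real.exp (C * n)} := by
    ext z
    constructor
    · intro hz
      obtain ⟨C, hC, -⟩ := EReal.lt_iff_exists_real_btwn.mp hz
      exact ⟨C, fun n hn => (logRoot_le_coe_iff hn _ _ _).mp
        ((le_iSup₂ (f := fun (n : ℕ) (_ : 1 ≤ n) => logRoot n (P n) (DiskHull.incl hB z))
          n hn).trans hC.le)⟩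
    · rintro ⟨C, hC⟩
      exact (iSup₂_le fun n hn => (logRoot_le_coe_iff hn _ _ _).mpr (hC n hn)).trans_lt
        (EReal.coe_lt_top C)
  rw [hAset] at hA
  -- A single point of boundedness controls the members of degree zero, which are constant.
  obtain ⟨z₀, C₀, hC₀⟩ : {z : DiskHull hB |
      ∃ C : ℝ, ∀ n, 1 ≤ n → ‖P n (DiskHull.incl hB z)‖ ≤ Real.exp (C * n)}.Nonempty := by
    rw [Set.nonempty_iff_ne_empty]
    intro h
    exact hA (h ▸ isProjectivelyPluripolar_empty)
  by_cases hM : ∃ C : ℝ, ∀ n, 1 ≤ n → ‖P n (b n)‖ ≤ Real.exp (C * n)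
  · obtain ⟨C, hC⟩ := hM
    intro x
    refine ⟨_, Metric.ball_mem_nhds x one_pos, C + Real.log (‖x‖ + 1), fun n hn y hy => ?_⟩
    refine (logRoot_le_coe_iff hn _ _ _).mpr ?_
    have hx1 : 0 < ‖x‖ + 1 := by positivity
    have hy1 : ‖y‖ ≤ ‖x‖ + 1 := by
      rw [mem_ball_iff_norm'] at hy
      linarith [norm_sub_norm_le y x, norm_sub_rev x y]
    calc _ ≤ ‖P n (b n)‖ * ‖y‖ ^ k n := (hQ n hn).norm_le y
      _ ≤ Real.exp (C * n) * (‖x‖ + 1) ^ n := by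
        refine mul_le_mul (hC n hn) ?_ (by positivity) (by positivity)
        exact (pow_le_pow_left₀ (norm_nonneg y) hy1 _).trans
          (pow_le_pow_right₀ (by linarith [norm_nonneg x]) (hkn n hn))
      _ = _ := by
        rw [add_mul, Real.exp_add, mul_comm (Real.log _), Real.exp_nat_mul, Real.exp_log hx1]
  · refine absurd (isProjectivelyPluripolar_of_exp_lt (DiskHull.exists_forall_mem_closedBall hB)
      hQ hkn hatt fun C => ?_) hA
    push Not at hM
    -- Exceeding `C₀` as well forces `k n ≥ 1`: a constant `P n` would violate the bound at `z₀`.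
    obtain ⟨n, hn, hlt⟩ := hM (max C C₀)
    have hle : ∀ D ≤ max C C₀, Real.exp (D * n) < ‖P n (b n)‖ := fun D hD =>
      (Real.exp_le_exp.mpr (mul_le_mul_of_nonneg_right hD n.cast_nonneg)).trans_lt hlt
    refine ⟨n, hn, Nat.one_le_iff_ne_zero.mpr fun hk => ?_, hle C (le_max_left _ _)⟩
    have hconst : ∀ e, P n e = P n 0 := fun e => by
      have h := (hP n hn).map_smul 0 e
      rw [hk, zero_smul, pow_zero, one_mul] at h
      exact h.symm
    have h1 := hC₀ n hn
    have h2 := hle C₀ (le_max_right _ _)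
    rw [hconst] at h1 h2
    exact absurd h1 (not_le.mpr h2)
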